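/- Let $N$ be a finite set with $n>1$ elements and let $a\in N$. A polymatroid on $N$ is a function $f:2^N\to\mathbb R$ with $f(\emptyset)=0$, $f(A)\le f(B)$ whenever $A\subseteq B\subseteq N$, and $f(A)+f(B)\ge f(A\cap B)+f(A\cup B)$ for all $A,B\subseteq N$; for $b\in N$ write $f(b)$ for $f(\{b\})$. A polymatroid $h$ does not depend on $a$ if $h(A\cup\{a\})=h(A)$ for all $A\subseteq N\setminus\{a\}$. A polymatroid $f$ is $a$-reduced if, for every decomposition $f=g+h$ into polymatroids $g,h$ on $N$ such that $h$ does not depend on $a$, the function $h$ is identically zero. Let $$\lambda_n=\sup\Bigl\{\max_{b\in N}\frac{f(b)}{f(a)} : f \text{ is an } a\text{-reduced polymatroid on } N \text{ with } f(a)>0\Bigr\}\in[-\infty,\infty].$$ Then $$\frac{n}{2\log_2 n}\le\lambda_n<2^{2^n};$$ in particular the supremum is finite. -/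

import Mathlib

/-- A polymatroid (polymatroidal rank function) on `N`: a real-valued function on the subsets of
`N` which is pointed, monotone and submodular. -/
structure IsPolymatroid {N : Type*} [DecidableEq N] (f : Finset N → ℝ) : Prop where
  pointed : f ∅ = 0
  monotone : ∀ A B : Finset N, A ⊆ B → f A ≤ f B
  submodular : ∀ A B : Finset N, f (A ∩ B) + f (A ∪ B) ≤ f A + f B

/-- The set function `h` does not depend on `a`: `h ({a} ∪ A) = h A` for all `A ⊆ N \ {a}`. -/
def NotDependsOn {N : Type*} [DecidableEq N] (h : Finset N → ℝ) (a : N) : Prop :=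
  ∀ A : Finset N, a ∉ A → h (insert a A) = h A

/-- `f` is an `a`-reduced polymatroid: whenever `f = g + h` with polymatroids `g` and `h` such that
`h` does not depend on `a`, the function `h` is identically zero. -/
def IsReducedPolymatroid {N : Type*} [DecidableEq N] (f : Finset N → ℝ) (a : N) : Prop :=
  IsPolymatroid f ∧
    ∀ g h : Finset N → ℝ, IsPolymatroid g → IsPolymatroid h → f = g + h →
      NotDependsOn h a → h = 0

/-- The quantity `C_{f,a} = max_{b ∈ N} f(b) / f(a)` (used only when `f(a) > 0`). -/
noncomputable def maxRatio {N : Type*} [Fintype N] (f : Finset N → ℝ) (a : N) : ℝ :=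
  Finset.univ.sup' ⟨a, Finset.mem_univ a⟩ (fun b : N => f {b} / f {a})

/-- The supremum of `C_{f,a}` over all `a`-reduced polymatroids `f` on `N` with `f(a) > 0`, taken
in the extended reals. By relabelling it depends only on the number `n` of elements of `N`; it is
the number `λ_n`. -/
noncomputable def reducedLambda {N : Type*} [Fintype N] [DecidableEq N] (a : N) : EReal :=
  sSup {c : EReal | ∃ f : Finset N → ℝ,
    IsReducedPolymatroid f a ∧ 0 < f {a} ∧ c = ((maxRatio f a : ℝ) : EReal)}

/-! Upper bound: polymatroids form a cone cut out by finitely many integer inequalities. Fix `b` and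
move a reduced `f` inside this cone, keeping `f(a)` and not decreasing `f(b)`, until the tight
inequalities together with `f(a)` determine it (`exists_determined_by_tight`). Such a motion always
hits a facet, since a direction that never did would be a polymatroid vanishing at `a`, which
reducedness excludes. The end point solves a nonsingular integer system, and Cramer's rule with
Hadamard's inequality bounds its values (`abs_le_of_determined_by_tight`).

Lower bound: the increments `f(X ∪ {a}) - f(X)` do not change when a summand independent of `a` is
removed. Hence a polymatroid realizing Csirmaz's access structure can be reduced and still realizes
it. Csirmaz's argument then forces a large rank on a set of about `log₂ n` elements
(`exists_isReducedPolymatroid_mul_le`), and by subadditivity one of these elements has a large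
value. -/

open Matrix

/-- **Hadamard's inequality** for real determinants. -/
theorem abs_det_le_prod_sqrt {ι : Type*} [Fintype ι] [DecidableEq ι] (M : Matrix ι ι ℝ) :
    |M.det| ≤ ∏ i, √(∑ j, M i j ^ 2) := by
  have key : ∀ (m : ℕ) (M : Matrix (Fin m) (Fin m) ℝ),
      |M.det| ≤ ∏ i, √(∑ j, M i j ^ 2) := by
    intro m M
    have : Fact (Module.finrank ℝ (EuclideanSpace ℝ (Fin m)) = m) := ⟨by simp⟩
    let b := EuclideanSpace.basisFun (Fin m) ℝ
    let v : Fin m → EuclideanSpace ℝ (Fin m) := fun i => WithLp.toLp 2 (M i)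
    have h := b.toBasis.orientation.abs_volumeForm_apply_le v
    rw [Orientation.volumeForm_robust' _ b v, Module.Basis.det_apply] at h
    have h1 : b.toBasis.toMatrix v = Mᵀ := by
      ext i j
      simp [Module.Basis.toMatrix_apply, b, v]
    rw [h1, det_transpose] at h
    simpa [EuclideanSpace.norm_eq, v] using h
  let e := Fintype.equivFin ι
  have h := key _ (M.submatrix e.symm e.symm)
  rw [det_submatrix_equiv_self] at h
  refine h.trans_eq ?_
  rw [← e.symm.prod_comp (fun i => √(∑ j, M i j ^ 2))]
  refine Finset.prod_congr rfl fun i _ => ?_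
  rw [← e.symm.sum_comp (fun j => M (e.symm i) j ^ 2)]
  rfl

/-! ### Upper bound: tight inequalities, Cramer's rule and Hadamard's inequality. -/

section

variable {N : Type*} [DecidableEq N]

/-- The coefficients of the inequalities which define polymatroids: monotonicity for a pair of
nested sets, and submodularity for a pair of incomparable sets. -/
def polymatroidRow : (Finset N × Finset N) ⊕ (Finset N × Finset N) → Finset N → ℤ
  | .inl (A, B), C => if A ⊆ B then (if C = B then 1 else 0) - (if C = A then 1 else 0) else 0
  | .inr (A, B), C => if A ⊆ B ∨ B ⊆ A then 0 else
      (if C = A then 1 else 0) + (if C = B then 1 else 0) -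
        ((if C = A ∩ B then 1 else 0) + (if C = A ∪ B then 1 else 0))

/-- Submodularity bounds the increment caused by adding `a` to any set by `h {a}`. -/
theorem IsPolymatroid.notDependsOn {h : Finset N → ℝ} {a : N} (hh : IsPolymatroid h)
    (ha : h {a} = 0) : NotDependsOn h a := by
  intro A hA
  refine le_antisymm ?_ (hh.monotone _ _ (Finset.subset_insert a A))
  have := hh.submodular {a} A
  rw [Finset.singleton_inter_of_notMem hA, ← Finset.insert_eq, hh.pointed, ha] at this
  linarith

variable [Fintype N]

theorem sum_polymatroidRow_sq_le (k : (Finset N × Finset N) ⊕ (Finset N × Finset N)) :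
    ∑ C, polymatroidRow k C ^ 2 ≤ 4 := by
  rcases k with ⟨A, B⟩ | ⟨A, B⟩
  · by_cases h : A ⊆ B
    · have : ∀ C, polymatroidRow (.inl (A, B)) C ^ 2 ≤
          (if C = B then 1 else 0) + (if C = A then 1 else 0) := by
        intro C
        simp only [polymatroidRow, if_pos h]
        split_ifs <;> norm_num
      refine (Finset.sum_le_sum fun C _ => this C).trans ?_
      simp [Finset.sum_add_distrib]
    · simp [polymatroidRow, h]
  · by_cases h : A ⊆ B ∨ B ⊆ A
    · simp [polymatroidRow, h]
    · have h1 : A ≠ B := fun e => h (by simp [e])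
      have h2 : A ∩ B ≠ A ∪ B := fun e => h <| Or.inl <|
        Finset.subset_union_left.trans (e.symm.subset.trans Finset.inter_subset_right)
      have : ∀ C, polymatroidRow (.inr (A, B)) C ^ 2 ≤
          (if C = A then 1 else 0) + (if C = B then 1 else 0) +
            ((if C = A ∩ B then 1 else 0) + (if C = A ∪ B then 1 else 0)) := by
        intro C
        simp only [polymatroidRow, if_neg h]
        split_ifs <;> first
          | (norm_num; done)
          | exact absurd (‹C = A›.symm.trans ‹C = B›) h1
          | exact absurd (‹C = A ∩ B›.symm.trans ‹C = A ∪ B›) h2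
      refine (Finset.sum_le_sum fun C _ => this C).trans ?_
      simp [Finset.sum_add_distrib]

/-- The value of a defining inequality of polymatroids at a set function. -/
def polymatroidValue (k : (Finset N × Finset N) ⊕ (Finset N × Finset N)) :
    (Finset N → ℝ) →ₗ[ℝ] ℝ where
  toFun f := ∑ C, (polymatroidRow k C : ℝ) * f C
  map_add' f g := by simp [mul_add, Finset.sum_add_distrib]
  map_smul' c f := by
    simp only [Pi.smul_apply, smul_eq_mul, RingHom.id_apply, Finset.mul_sum]
    exact Finset.sum_congr rfl fun C _ => by ring

theorem polymatroidValue_apply (k : (Finset N × Finset N) ⊕ (Finset N × Finset N))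
    (f : Finset N → ℝ) : polymatroidValue k f = ∑ C, (polymatroidRow k C : ℝ) * f C := rfl

theorem polymatroidValue_inl {A B : Finset N} (h : A ⊆ B) (f : Finset N → ℝ) :
    polymatroidValue (.inl (A, B)) f = f B - f A := by
  simp [polymatroidValue_apply, polymatroidRow, h, sub_mul, Finset.sum_sub_distrib]

theorem polymatroidValue_inr {A B : Finset N} (h : ¬ (A ⊆ B ∨ B ⊆ A)) (f : Finset N → ℝ) :
    polymatroidValue (.inr (A, B)) f = f A + f B - (f (A ∩ B) + f (A ∪ B)) := by
  simp only [polymatroidValue_apply, polymatroidRow, if_neg h]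
  simp [sub_mul, add_mul, Finset.sum_sub_distrib, Finset.sum_add_distrib]

theorem isPolymatroid_iff_polymatroidValue_nonneg {f : Finset N → ℝ} :
    IsPolymatroid f ↔ f ∅ = 0 ∧ ∀ k, 0 ≤ polymatroidValue k f := by
  constructor
  · intro hf
    refine ⟨hf.pointed, ?_⟩
    rintro (⟨A, B⟩ | ⟨A, B⟩)
    · by_cases h : A ⊆ B
      · rw [polymatroidValue_inl h]
        linarith [hf.monotone A B h]
      · simp [polymatroidValue_apply, polymatroidRow, h]
    · by_cases h : A ⊆ B ∨ B ⊆ A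
      · simp [polymatroidValue_apply, polymatroidRow, h]
      · rw [polymatroidValue_inr h]
        linarith [hf.submodular A B]
  · rintro ⟨h0, hf⟩
    refine ⟨h0, fun A B h => ?_, fun A B => ?_⟩
    · have := hf (.inl (A, B))
      rw [polymatroidValue_inl h] at this
      linarith
    · by_cases h : A ⊆ B ∨ B ⊆ A
      · rcases h with h | h
        · rw [Finset.inter_eq_left.2 h, Finset.union_eq_right.2 h]
        · rw [Finset.inter_eq_right.2 h, Finset.union_eq_left.2 h, add_comm]
      · have := hf (.inr (A, B))
        rw [polymatroidValue_inr h] at this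
        linarith

/-- A small multiple of a polymatroid can be split off from every polymatroid all of whose tight
inequalities it satisfies with equality. -/
theorem exists_pos_isPolymatroid_sub_smul {f x : Finset N → ℝ} (hf : IsPolymatroid f)
    (hx0 : x ∅ = 0)
    (hx : ∀ k, polymatroidValue k f = 0 → polymatroidValue k x = 0) :
    ∃ ε : ℝ, 0 < ε ∧ IsPolymatroid (f - ε • x) := by
  obtain ⟨hf0, hf⟩ := isPolymatroid_iff_polymatroidValue_nonneg.1 hf
  -- Tight inequalities stay tight for every `ε`; the finitely many strict ones survive for small
  -- `ε` by continuity.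
  have hev : ∀ᶠ ε : ℝ in nhdsWithin 0 (Set.Ioi 0), ∀ k, 0 ≤ polymatroidValue k (f - ε • x) := by
    rw [Filter.eventually_all]
    intro k
    rcases (hf k).eq_or_lt with h | h
    · refine Filter.Eventually.of_forall fun ε => ?_
      simp [← h, hx k h.symm]
    · have ht : Filter.Tendsto (fun ε : ℝ => polymatroidValue k (f - ε • x)) (nhds 0)
          (nhds (polymatroidValue k f)) := by
        simp only [map_sub, map_smul, smul_eq_mul]
        have : Continuous fun ε : ℝ => polymatroidValue k f - ε * polymatroidValue k x := by
          fun_prop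
        simpa using this.tendsto 0
      exact ((ht.eventually (lt_mem_nhds h)).mono fun _ h => h.le).filter_mono nhdsWithin_le_nhds
  obtain ⟨ε, h1, h2⟩ := (hev.and self_mem_nhdsWithin).exists
  exact ⟨ε, h2, isPolymatroid_iff_polymatroidValue_nonneg.2 ⟨by simp [hf0, hx0], h1⟩⟩

theorem IsPolymatroid.smul {f : Finset N → ℝ} (hf : IsPolymatroid f) {c : ℝ} (hc : 0 ≤ c) :
    IsPolymatroid (c • f) := by
  obtain ⟨h0, h⟩ := isPolymatroid_iff_polymatroidValue_nonneg.1 hf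
  exact isPolymatroid_iff_polymatroidValue_nonneg.2
    ⟨by simp [h0], fun k => by simpa using mul_nonneg hc (h k)⟩

/-- This form of reducedness refers to `f` only through its tight inequalities, so it persists when
more of them become tight. -/
theorem IsReducedPolymatroid.eq_zero {f h : Finset N → ℝ} {a : N} (hf : IsReducedPolymatroid f a)
    (hh : IsPolymatroid h) (ha : NotDependsOn h a)
    (ht : ∀ k, polymatroidValue k f = 0 → polymatroidValue k h = 0) : h = 0 := by
  obtain ⟨ε, hε, hg⟩ := exists_pos_isPolymatroid_sub_smul hf.1 hh.pointed ht
  have := hf.2 (f - ε • h) (ε • h) hg (hh.smul hε.le) (by simp)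
    fun A hA => by simp [ha A hA]
  exact (smul_eq_zero.1 this).resolve_left hε.ne'

/-- An `a`-reduced polymatroid can be moved, without changing its value at `a` and without
decreasing its value at `b`, to one which is determined by its tight inequalities up to scaling. -/
theorem exists_determined_by_tight {f : Finset N → ℝ} {a : N} (b : N) (hf : IsPolymatroid f)
    (hr : ∀ h, IsPolymatroid h → NotDependsOn h a →
      (∀ k, polymatroidValue k f = 0 → polymatroidValue k h = 0) → h = 0) :
    ∃ g : Finset N → ℝ, IsPolymatroid g ∧ g {a} = f {a} ∧ f {b} ≤ g {b} ∧
      ∀ x : Finset N → ℝ, x ∅ = 0 → x {a} = 0 →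
        (∀ k, polymatroidValue k g = 0 → polymatroidValue k x = 0) → x = 0 := by
  classical
  -- Induction on the number of strict inequalities; each motion makes at least one more tight.
  induction hm : (Finset.univ.filter fun k => polymatroidValue k f ≠ 0).card using
    Nat.strong_induction_on generalizing f with
  | _ m ih =>
  by_contra! hcon
  obtain ⟨x, hx0, hxa, hxt, hxb, hxne⟩ : ∃ x : Finset N → ℝ, x ∅ = 0 ∧ x {a} = 0 ∧
      (∀ k, polymatroidValue k f = 0 → polymatroidValue k x = 0) ∧ 0 ≤ x {b} ∧ x ≠ 0 := by
    obtain ⟨x, hx0, hxa, hxt, hxne⟩ := hcon f hf rfl le_rfl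
    rcases le_total 0 (x {b}) with h | h
    · exact ⟨x, hx0, hxa, hxt, h, hxne⟩
    · exact ⟨-x, by simpa, by simpa, fun k hk => by simp [hxt k hk], by simpa, by simpa⟩
  obtain ⟨hf0, hfk⟩ := isPolymatroid_iff_polymatroidValue_nonneg.1 hf
  have hneg : (Finset.univ.filter fun k => polymatroidValue k x < 0).Nonempty := by
    by_contra hempty
    have hxk : ∀ k, 0 ≤ polymatroidValue k x := fun k => by
      by_contra! hk
      exact hempty ⟨k, by simpa using hk⟩
    have hx := isPolymatroid_iff_polymatroidValue_nonneg.2 ⟨hx0, hxk⟩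
    exact hxne (hr x hx (hx.notDependsOn hxa) hxt)
  obtain ⟨k, hk, hmin⟩ := Finset.exists_min_image _
    (fun k => polymatroidValue k f / (-polymatroidValue k x)) hneg
  simp only [Finset.mem_filter, Finset.mem_univ, true_and] at hk hmin
  -- The largest step along `x` that stays in the cone: the inequality `k` is the first to become
  -- tight.
  set t := polymatroidValue k f / (-polymatroidValue k x) with ht
  have ht0 : 0 ≤ t := div_nonneg (hfk k) (by linarith)
  have hfx : ∀ j, polymatroidValue j f = 0 → polymatroidValue j (f + t • x) = 0 :=
    fun j hj => by simp [hj, hxt j hj]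
  have hg : IsPolymatroid (f + t • x) := by
    refine isPolymatroid_iff_polymatroidValue_nonneg.2 ⟨by simp [hf0, hx0], fun j => ?_⟩
    rw [map_add, map_smul, smul_eq_mul]
    rcases lt_or_ge (polymatroidValue j x) 0 with hj | hj
    · have := hmin j hj
      rw [le_div_iff₀ (by linarith)] at this
      linarith
    · exact add_nonneg (hfk j) (mul_nonneg ht0 hj)
  have hk0 : polymatroidValue k (f + t • x) = 0 := by
    rw [map_add, map_smul, smul_eq_mul, ht, div_neg, neg_mul, div_mul_cancel₀ _ hk.ne]
    ring
  have hlt : (Finset.univ.filter fun k => polymatroidValue k (f + t • x) ≠ 0).card < m := by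
    rw [← hm]
    refine Finset.card_lt_card ?_
    rw [Finset.ssubset_iff_of_subset]
    · exact ⟨k, by simpa using fun h => hk.ne (hxt k h), by simpa using hk0⟩
    · intro j
      simp only [Finset.mem_filter, Finset.mem_univ, true_and]
      exact mt (hfx j)
  obtain ⟨g, h1, h2, h3, h4⟩ := ih _ hlt hg
    (fun h hh ha hk => hr h hh ha fun j hj => hk j (hfx j hj)) rfl
  obtain ⟨y, y1, y2, y3, y4⟩ := hcon g h1 (by simpa [hxa] using h2)
    (le_trans (by simpa using mul_nonneg ht0 hxb) h3)
  exact y4 (h4 y y1 y2 y3)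

/-- The upper bound which Cramer's rule and Hadamard's inequality give for the value at `B` of a
set function which is determined by its tight inequalities and its value at `a`. -/
theorem abs_le_of_determined_by_tight {f : Finset N → ℝ} {a : N} (hf0 : f ∅ = 0)
    (ha : 0 < f {a})
    (hdet : ∀ x : Finset N → ℝ, x ∅ = 0 → x {a} = 0 →
        (∀ k, polymatroidValue k f = 0 → polymatroidValue k x = 0) → x = 0) (B : Finset N) :
    |f B| ≤ √2 * 2 ^ (2 ^ Fintype.card N - 1) * f {a} := by
  classical
  -- Rows `z` of integer equations `z · f = y f(a)`. The norm bounds concern the row with its entry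
  -- in column `B` replaced by `y`, as in the numerator of Cramer's rule.
  let S : Set (Finset N → ℝ) := {v | ∃ (z : Finset N → ℤ) (y : ℤ), v = (fun C => (z C : ℝ)) ∧
    (y = 0 ∨ y = 1) ∧ ∑ C, (z C : ℝ) * f C = y * f {a} ∧
    ∑ C, Function.update z B y C ^ 2 ≤ 4 ∧ (y = 1 → ∑ C, Function.update z B y C ^ 2 ≤ 2)}
  have hupd : ∀ (z : Finset N → ℤ) (y : ℤ),
      ∑ C, Function.update z B y C ^ 2 ≤ ∑ C, z C ^ 2 + y ^ 2 := by
    intro z y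
    rw [← Finset.add_sum_erase _ _ (Finset.mem_univ B),
      ← Finset.add_sum_erase _ (fun C => z C ^ 2) (Finset.mem_univ B)]
    have : ∑ C ∈ Finset.univ.erase B, Function.update z B y C ^ 2 =
        ∑ C ∈ Finset.univ.erase B, z C ^ 2 :=
      Finset.sum_congr rfl fun C hC => by
        rw [Function.update_of_ne (Finset.ne_of_mem_erase hC)]
    rw [this, Function.update_self]
    nlinarith [sq_nonneg (z B)]
  have hSe : ∀ (D : Finset N) (y : ℤ), (y = 0 ∨ y = 1) → f D = y * f {a} →
      (fun C => if C = D then (1 : ℝ) else 0) ∈ S := by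
    intro D y hy hD
    have h := hupd (fun C => if C = D then 1 else 0) y
    simp only [ite_pow, one_pow, ne_eq, OfNat.ofNat_ne_zero, not_false_eq_true, zero_pow,
      Finset.sum_ite_eq', Finset.mem_univ, if_true] at h
    have hy2 : y ^ 2 ≤ 1 := by rcases hy with rfl | rfl <;> norm_num
    exact ⟨fun C => if C = D then 1 else 0, y, by simp, hy, by simpa using hD,
      by linarith, fun _ => by linarith⟩
  have hSk : ∀ k, polymatroidValue k f = 0 → (fun C => (polymatroidRow k C : ℝ)) ∈ S := by
    intro k hk
    have h := hupd (polymatroidRow k) 0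
    exact ⟨polymatroidRow k, 0, rfl, .inl rfl, by simpa [polymatroidValue_apply] using hk,
      by linarith [sum_polymatroidRow_sq_le k], fun h => by simp at h⟩
  -- A functional vanishing on `S` is given by a vector `x` to which `hdet` applies, so it is zero.
  have hspan : ⊤ ≤ Submodule.span ℝ S := by
    by_contra hlt
    obtain ⟨φ, hφ, hker⟩ := Submodule.exists_le_ker_of_lt_top _ (lt_top_iff_ne_top.2
      fun h => hlt h.ge)
    have happ : ∀ v : Finset N → ℝ, φ v = ∑ C, v C * φ (Pi.single C 1) := by
      intro v
      conv_lhs => rw [← Finset.univ_sum_single v]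
      rw [map_sum]
      refine Finset.sum_congr rfl fun C _ => ?_
      rw [← smul_eq_mul, ← map_smul, ← Pi.single_smul, smul_eq_mul, mul_one]
    have hS : ∀ v ∈ S, ∑ C, v C * φ (Pi.single C 1) = 0 := fun v hv => by
      rw [← happ]
      exact hker (Submodule.subset_span hv)
    have hx := hdet (fun C => φ (Pi.single C 1))
      (by simpa using hS _ (hSe ∅ 0 (.inl rfl) (by simp [hf0])))
      (by simpa using hS _ (hSe {a} 1 (.inr rfl) (by simp)))
      (fun k hk => by simpa [polymatroidValue_apply] using hS _ (hSk k hk))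
    apply hφ
    refine LinearMap.ext fun v => ?_
    rw [happ]
    exact Finset.sum_eq_zero fun C _ => by rw [congrFun hx C]; simp
  obtain ⟨e⟩ : Nonempty ((linearIndepOn_empty ℝ id).extend (Set.empty_subset S) ≃ Finset N) := by
    have b := Module.Basis.ofSpan hspan
    exact ⟨b.indexEquiv (Pi.basisFun ℝ (Finset N))⟩
  let b := (Module.Basis.ofSpan hspan).reindex e
  have hbS : ∀ i, b i ∈ S := fun i => Module.Basis.ofSpan_subset hspan (by simp [b])
  choose z y hz hy hzf hz4 hz2 using hbS
  let M : Matrix (Finset N) (Finset N) ℤ := z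
  have hMdet : M.det ≠ 0 := by
    have h1 : IsUnit (M.map (Int.cast : ℤ → ℝ)) := by
      rw [← Matrix.linearIndependent_rows_iff_isUnit]
      convert! b.linearIndependent using 1
      ext i
      rw [hz i]
      rfl
    intro h
    have h2 := (Matrix.isUnit_iff_isUnit_det _).1 h1
    have h3 : (M.map (Int.cast : ℤ → ℝ)).det = ((M.det : ℤ) : ℝ) :=
      (RingHom.map_det (Int.castRingHom ℝ) M).symm
    rw [h3, h] at h2
    simp at h2
  have hcramer : (M.det : ℝ) * f B = ((M.updateCol B y).det : ℝ) * f {a} := by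
    let MR : Matrix (Finset N) (Finset N) ℝ := M.map (Int.cast : ℤ → ℝ)
    have h1 : MR *ᵥ f = f {a} • fun i => (y i : ℝ) := by
      ext i
      rw [Pi.smul_apply, smul_eq_mul, mul_comm, ← hzf i]
      rfl
    have h2 : MR.det • f = MR.cramer (MR *ᵥ f) := by
      rw [Matrix.cramer_eq_adjugate_mulVec, Matrix.mulVec_mulVec, Matrix.adjugate_mul,
        Matrix.smul_mulVec, Matrix.one_mulVec]
    have h3 := congrFun h2 B
    rw [h1, map_smul, Pi.smul_apply, Pi.smul_apply, Matrix.cramer_apply, smul_eq_mul,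
      smul_eq_mul] at h3
    have h4 : MR.det = ((M.det : ℤ) : ℝ) := (RingHom.map_det (Int.castRingHom ℝ) M).symm
    have h5 : (MR.updateCol B fun i => (y i : ℝ)).det = ((M.updateCol B y).det : ℝ) := by
      rw [show (((M.updateCol B y).det : ℤ) : ℝ) = _ from
        RingHom.map_det (Int.castRingHom ℝ) (M.updateCol B y)]
      congr 1
      ext i j
      by_cases hj : j = B
      · subst hj; simp
      · simp [Matrix.updateCol_ne hj, MR]
    rw [h4, h5] at h3
    linarith
  -- If every right-hand side were zero, pairing with `f` would vanish on a basis, contrary to `f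
  -- {a} > 0`. This row contributes `√2` instead of `2` to Hadamard's product, which makes the final
  -- bound strict.
  obtain ⟨i₀, hi₀⟩ : ∃ i, y i = 1 := by
    by_contra! hne
    have hy0 : y = 0 := funext fun i => (hy i).resolve_right (hne i)
    have h0 : ∀ i, ∑ C, (b i) C * f C = 0 := fun i => by
      rw [hz i, hzf i, hy0]
      simp
    let ψ : (Finset N → ℝ) →ₗ[ℝ] ℝ := Fintype.linearCombination ℝ f
    have hψ : ψ = 0 := b.ext fun i => by
      simpa [ψ, Fintype.linearCombination_apply] using h0 i
    have := LinearMap.congr_fun hψ (Pi.single {a} 1)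
    simp [ψ, Fintype.linearCombination_apply_single] at this
    exact ha.ne' this
  have hhad : |((M.updateCol B y).det : ℝ)| ≤ √2 * 2 ^ (2 ^ Fintype.card N - 1) := by
    rw [show (((M.updateCol B y).det : ℤ) : ℝ) = _ from
        RingHom.map_det (Int.castRingHom ℝ) (M.updateCol B y)]
    refine (abs_det_le_prod_sqrt _).trans ?_
    have hrow : ∀ i, ∑ j, ((Int.castRingHom ℝ).mapMatrix (M.updateCol B y)) i j ^ 2 =
        ((∑ C, Function.update (z i) B (y i) C ^ 2 : ℤ) : ℝ) := by
      intro i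
      push_cast
      refine Finset.sum_congr rfl fun j _ => ?_
      by_cases hj : j = B
      · subst hj; simp
      · rw [RingHom.mapMatrix_apply, Matrix.map_apply, Matrix.updateCol_ne hj,
          Function.update_of_ne hj]
        rfl
    simp only [hrow]
    rw [← Finset.mul_prod_erase _ _ (Finset.mem_univ i₀)]
    have hcard : (Finset.univ.erase i₀).card = 2 ^ Fintype.card N - 1 := by
      rw [Finset.card_erase_of_mem (Finset.mem_univ _), Finset.card_univ, Fintype.card_finset]
    rw [← hcard]
    refine mul_le_mul (Real.sqrt_le_sqrt (by exact_mod_cast hz2 i₀ hi₀)) ?_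
      (Finset.prod_nonneg fun _ _ => Real.sqrt_nonneg _) (Real.sqrt_nonneg _)
    rw [← Finset.prod_const]
    refine Finset.prod_le_prod (fun _ _ => Real.sqrt_nonneg _) fun i _ => ?_
    rw [Real.sqrt_le_left (by norm_num)]
    have : ((∑ C, Function.update (z i) B (y i) C ^ 2 : ℤ) : ℝ) ≤ (4 : ℤ) := by
      exact_mod_cast hz4 i
    norm_num at this ⊢
    exact this
  have hone : (1 : ℝ) ≤ |(M.det : ℝ)| := by exact_mod_cast Int.one_le_abs hMdet
  calc |f B| ≤ |(M.det : ℝ)| * |f B| := le_mul_of_one_le_left (abs_nonneg _) hone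
    _ = |((M.updateCol B y).det : ℝ)| * f {a} := by
      rw [← abs_mul, hcramer, abs_mul, abs_of_pos ha]
    _ ≤ _ := mul_le_mul_of_nonneg_right hhad ha.le

theorem IsReducedPolymatroid.apply_le {f : Finset N → ℝ} {a : N} (hf : IsReducedPolymatroid f a)
    (ha : 0 < f {a}) (b : N) :
    f {b} ≤ √2 * 2 ^ (2 ^ Fintype.card N - 1) * f {a} := by
  obtain ⟨g, h1, h2, h3, h4⟩ := exists_determined_by_tight b hf.1
    fun h hh hha ht => hf.eq_zero hh hha ht
  have := abs_le_of_determined_by_tight h1.pointed (h2 ▸ ha) h4 {b}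
  rw [h2] at this
  exact h3.trans ((le_abs_self _).trans this)

theorem reducedLambda_lt (a : N) :
    reducedLambda a < (((2 : ℝ) ^ (2 ^ Fintype.card N : ℕ) : ℝ) : EReal) := by
  have h1 : reducedLambda a ≤ ((√2 * 2 ^ (2 ^ Fintype.card N - 1) : ℝ) : EReal) := by
    refine sSup_le ?_
    rintro c ⟨f, hf, ha, rfl⟩
    rw [EReal.coe_le_coe_iff]
    refine Finset.sup'_le _ _ fun b _ => ?_
    rw [div_le_iff₀ ha]
    exact hf.apply_le ha b
  refine h1.trans_lt ?_
  rw [EReal.coe_lt_coe_iff]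
  have h2 : 2 ^ Fintype.card N ≠ 0 := by positivity
  calc √2 * 2 ^ (2 ^ Fintype.card N - 1) < 2 * (2 : ℝ) ^ (2 ^ Fintype.card N - 1) := by
        refine mul_lt_mul_of_pos_right ?_ (by positivity)
        rw [Real.sqrt_lt' (by norm_num)]
        norm_num
    _ = 2 ^ (2 ^ Fintype.card N) := mul_pow_sub_one h2 2

end

/-! ### Lower bound: Csirmaz's access structure and its reduced realizations. -/

section

variable {N : Type*} [DecidableEq N]

theorem IsPolymatroid.nonneg {f : Finset N → ℝ} (hf : IsPolymatroid f) (A : Finset N) :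
    0 ≤ f A :=
  hf.pointed ▸ hf.monotone ∅ A (Finset.empty_subset A)

theorem IsPolymatroid.le_sum_singleton {f : Finset N → ℝ} (hf : IsPolymatroid f)
    (A : Finset N) : f A ≤ ∑ x ∈ A, f {x} := by
  induction A using Finset.induction_on with
  | empty => simp [hf.pointed]
  | insert x A hx ih =>
    have := hf.submodular {x} A
    rw [Finset.singleton_inter_of_notMem hx, ← Finset.insert_eq, hf.pointed] at this
    rw [Finset.sum_insert hx]
    linarith

theorem IsPolymatroid.add {f g : Finset N → ℝ} (hf : IsPolymatroid f) (hg : IsPolymatroid g) :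
    IsPolymatroid (f + g) where
  pointed := by simp [hf.pointed, hg.pointed]
  monotone A B h := add_le_add (hf.monotone A B h) (hg.monotone A B h)
  submodular A B := by
    have := hf.submodular A B
    have := hg.submodular A B
    simp only [Pi.add_apply]
    linarith

/-- The lower bound of Csirmaz for the rank of a set of participants in an access structure `Γ`
which is realized by the polymatroid `g` with secret `a`. -/
theorem IsPolymatroid.mul_le_of_accessStructure {g : Finset N → ℝ} {a : N} (hg : IsPolymatroid g)
    (Γ : Finset N → Prop)
    (hΓ : ∀ X, a ∉ X → Γ X → g (insert a X) = g X)
    (hΓ' : ∀ X, a ∉ X → ¬ Γ X → g (insert a X) = g X + g {a})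
    {A : Finset N} {B T : ℕ → Finset N} {m : ℕ} (haA : a ∉ A) (haB : ∀ i, a ∉ B i)
    (hT : ∀ i, T i ⊆ A) (hB : ∀ i, B i ⊆ B (i + 1)) (hAB : ∀ i, Disjoint A (B i))
    (hB0 : B 0 = ∅)
    (hqA : ∀ i ≤ m, Γ (A ∪ B i)) (hqT : ∀ i ≤ m, Γ (T i ∪ B i))
    (hnT : ∀ i < m, ¬ Γ (T (i + 1) ∪ B i)) (hnB : ¬ Γ (B m)) :
    (m + 1) * g {a} ≤ g A := by
  -- Descending induction on `i = m - j`: each step from `i + 1` to `i` gains one more `g {a}`.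
  have key : ∀ j i : ℕ, i + j = m → (j + 1) * g {a} ≤ g (A ∪ B i) - g (B i) := by
    intro j
    induction j with
    | zero =>
      rintro i rfl
      have h1 := hΓ _ (by simp [haA, haB]) (hqA i (by simp))
      have h2 := hΓ' _ (haB i) hnB
      have h3 := hg.monotone (insert a (B i)) (insert a (A ∪ B i))
        (Finset.insert_subset_insert _ Finset.subset_union_right)
      push_cast
      linarith
    | succ j ih =>
      intro i hi
      have h1 := ih (i + 1) (by omega)
      have haT : a ∉ T (i + 1) := fun h => haA (hT _ h)
      -- With `a` adjoined, only the intersection `T (i + 1) ∪ B i` is unqualified; this is the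
      -- source of the extra `g {a}`.
      have h2 := hg.submodular (insert a (A ∪ B i)) (insert a (T (i + 1) ∪ B (i + 1)))
      rw [← Finset.insert_inter_distrib, ← Finset.insert_union_distrib] at h2
      have e1 : (A ∪ B i) ∩ (T (i + 1) ∪ B (i + 1)) = T (i + 1) ∪ B i := by
        ext x
        have := @hT (i + 1) x
        have := @hB i x
        have : x ∈ A → x ∉ B (i + 1) := fun h => Finset.disjoint_left.1 (hAB (i + 1)) h
        simp only [Finset.mem_inter, Finset.mem_union]
        tauto
      have e2 : (A ∪ B i) ∪ (T (i + 1) ∪ B (i + 1)) = A ∪ B (i + 1) := by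
        ext x
        have := @hT (i + 1) x
        have := @hB i x
        simp only [Finset.mem_union]
        tauto
      rw [e1, e2, hΓ _ (by simp [haA, haB]) (hqA i (by omega)),
        hΓ _ (by simp [haT, haB]) (hqT (i + 1) (by omega)),
        hΓ _ (by simp [haA, haB]) (hqA (i + 1) (by omega)),
        hΓ' _ (by simp [haT, haB]) (hnT i (by omega))] at h2
      have h3 := hg.submodular (T (i + 1) ∪ B i) (B (i + 1))
      have e3 : (T (i + 1) ∪ B i) ∩ B (i + 1) = B i := by
        ext x
        have := @hT (i + 1) x
        have := @hB i x
        have : x ∈ A → x ∉ B (i + 1) := fun h => Finset.disjoint_left.1 (hAB (i + 1)) h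
        simp only [Finset.mem_inter, Finset.mem_union]
        tauto
      have e4 : (T (i + 1) ∪ B i) ∪ B (i + 1) = T (i + 1) ∪ B (i + 1) := by
        rw [Finset.union_assoc, Finset.union_eq_right.2 (hB i)]
      rw [e3, e4] at h3
      push_cast
      linarith
  have := key m 0 (by simp)
  rwa [hB0, Finset.union_empty, hg.pointed, sub_zero] at this

/-- Nonempty subsets of an `l`-element set, listed so that no set contains an earlier one. -/
theorem exists_nonempty_finset_sequence (l : ℕ) :
    ∃ F : ℕ → Finset (Fin l), (∀ i < 2 ^ l - 1, (F i).Nonempty) ∧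
      ∀ i j, i < j → j < 2 ^ l - 1 → ¬ F i ⊆ F j := by
  -- Subsets are encoded in binary and listed by decreasing code; inclusion of sets would force the
  -- opposite order of codes.
  refine ⟨fun i => Finset.univ.filter fun x : Fin l => (2 ^ l - 1 - i).testBit x = true, ?_, ?_⟩
  · intro i hi
    by_contra h
    rw [Finset.not_nonempty_iff_eq_empty, Finset.filter_eq_empty_iff] at h
    have : 2 ^ l - 1 - i = 0 := Nat.eq_of_testBit_eq fun x => by
      rw [Nat.zero_testBit]
      by_cases hx : x < l
      · simpa using h (Finset.mem_univ (⟨x, hx⟩ : Fin l))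
      · refine Nat.testBit_eq_false_of_lt (lt_of_lt_of_le ?_ (Nat.pow_le_pow_right two_pos
          (not_lt.1 hx)))
        omega
    omega
  · intro i j hij hj h
    have : (2 ^ l - 1 - i) &&& (2 ^ l - 1 - j) = 2 ^ l - 1 - i := Nat.eq_of_testBit_eq fun x => by
      rw [Nat.testBit_and]
      by_cases hx : x < l
      · have := @h ⟨x, hx⟩
        simp only [Finset.mem_filter, Finset.mem_univ, true_and] at this
        cases h1 : (2 ^ l - 1 - i).testBit x
        · simp
        · simp [this h1]
      · rw [Nat.testBit_eq_false_of_lt (n := 2 ^ l - 1 - i)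
          (lt_of_lt_of_le (by omega) (Nat.pow_le_pow_right two_pos (not_lt.1 hx)))]
        simp
    have h2 : (2 ^ l - 1 - i) &&& (2 ^ l - 1 - j) ≤ 2 ^ l - 1 - j := Nat.and_le_right
    omega

variable [Fintype N]

theorem isClosed_setOf_isPolymatroid : IsClosed {f : Finset N → ℝ | IsPolymatroid f} := by
  simp only [isPolymatroid_iff_polymatroidValue_nonneg, Set.ofPred_and, Set.ofPred_forall]
  refine (isClosed_eq (continuous_apply _) continuous_const).inter (isClosed_iInter fun k => ?_)
  exact isClosed_le continuous_const (LinearMap.continuous_of_finiteDimensional _)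

/-- Every polymatroid becomes `a`-reduced after subtracting a suitable polymatroid which does not
depend on `a`. -/
theorem IsPolymatroid.exists_isReducedPolymatroid_sub {f : Finset N → ℝ} (hf : IsPolymatroid f)
    (a : N) : ∃ h : Finset N → ℝ, IsPolymatroid h ∧ NotDependsOn h a ∧
      IsReducedPolymatroid (f - h) a := by
  let K : Set (Finset N → ℝ) := {h | IsPolymatroid h ∧ IsPolymatroid (f - h) ∧ NotDependsOn h a}
  have hK : IsCompact K := by
    refine (isCompact_Icc (a := (0 : Finset N → ℝ)) (b := f)).of_isClosed_subset ?_ ?_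
    · refine isClosed_setOf_isPolymatroid.inter
        ((isClosed_setOf_isPolymatroid.preimage (continuous_const.sub continuous_id)).inter ?_)
      have : {h : Finset N → ℝ | NotDependsOn h a} =
          ⋂ (A : Finset N) (_ : a ∉ A), {h | h (insert a A) = h A} := by
        ext h
        simp [NotDependsOn]
      change IsClosed {h : Finset N → ℝ | NotDependsOn h a}
      rw [this]
      exact isClosed_iInter fun A => isClosed_iInter fun _ =>
        isClosed_eq (continuous_apply _) (continuous_apply _)
    · rintro h ⟨h1, h2, -⟩
      exact ⟨fun A => h1.nonneg A, fun A => sub_nonneg.1 (h2.nonneg A)⟩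
  have h0 : (0 : Finset N → ℝ) ∈ K := by
    refine ⟨⟨rfl, fun _ _ _ => le_rfl, fun _ _ => le_rfl⟩, by simpa using hf, fun _ _ => rfl⟩
  -- Take `h` with the largest total rank: a further summand `k` could be added to `h`, so `k` has
  -- rank at most zero on the whole set.
  obtain ⟨h, ⟨h1, h2, h3⟩, hmax⟩ := hK.exists_isMaxOn ⟨0, h0⟩
    (continuous_apply (Finset.univ : Finset N)).continuousOn
  refine ⟨h, h1, h3, h2, fun g k hg hk hgk hka => ?_⟩
  have hmem : h + k ∈ K := by
    refine ⟨h1.add hk, ?_, fun A hA => by simp [h3 A hA, hka A hA]⟩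
    rwa [← sub_sub, hgk, add_sub_cancel_right]
  have hle : h Finset.univ + k Finset.univ ≤ h Finset.univ := hmax hmem
  funext A
  refine le_antisymm ?_ (hk.nonneg A)
  have := hk.monotone A Finset.univ (Finset.subset_univ A)
  simp only [Pi.zero_apply]
  linarith

/-- Every upward closed family `Γ` which does not contain the empty set is the access structure of
a polymatroid with secret `a`. -/
theorem exists_isPolymatroid_of_accessStructure (a : N) (Γ : Finset N → Prop)
    (hΓ : ∀ X Y, X ⊆ Y → Γ X → Γ Y) :
    ∃ f : Finset N → ℝ, IsPolymatroid f ∧ (∀ X, a ∉ X → Γ X → f (insert a X) = f X) ∧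
      ∀ X, a ∉ X → ¬ Γ X → f (insert a X) = f X + 1 := by
  classical
  let s : Finset N → ℝ := fun X => if a ∈ X ∧ ¬ Γ (X.erase a) then 1 else 0
  let c : Finset N → ℝ := fun X => ((X.erase a).card : ℝ)
  -- The term in `c` is strictly concave: its growth is at least `1` per new element, and its
  -- submodularity slack is at least `2` when the traces off `a` are incomparable. This absorbs the
  -- `0`/`1` term `s`, which encodes `Γ`.
  let f : Finset N → ℝ := fun X => c X * (2 * Fintype.card N - c X) + s X
  have hs0 : ∀ X, 0 ≤ s X := fun X => by
    simp only [s]; split_ifs <;> norm_num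
  have hs1 : ∀ X, s X ≤ 1 := fun X => by
    simp only [s]; split_ifs <;> norm_num
  have hsmono : ∀ X Y, X ⊆ Y → X.erase a = Y.erase a → s X ≤ s Y := by
    intro X Y h he
    by_cases hX : a ∈ X
    · simp [s, hX, h hX, he]
    · simpa [s, hX] using hs0 Y
  have hsanti : ∀ X Y, a ∈ X → X.erase a ⊆ Y.erase a → s Y ≤ s X := by
    intro X Y hX he
    by_cases hY : Γ (X.erase a)
    · simp [s, hY, hΓ _ _ he hY]
    · simpa [s, hX, hY] using hs1 Y
  have hcN : ∀ X, c X ≤ Fintype.card N := fun X => by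
    simpa [c] using Finset.card_le_univ (X.erase a)
  have hclt : ∀ {X Y : Finset N}, X.erase a ⊂ Y.erase a → c X + 1 ≤ c Y := fun h => by
    have := Nat.succ_le_of_lt (Finset.card_lt_card h)
    simp only [c]
    exact_mod_cast this
  have hinter : ∀ X Y : Finset N, (X ∩ Y).erase a = X.erase a ∩ Y.erase a := fun X Y => by
    ext x
    simp only [Finset.mem_erase, Finset.mem_inter]
    tauto
  refine ⟨f, ⟨?_, ?_, ?_⟩, ?_, ?_⟩
  · simp [f, c, s]
  · intro A B hAB
    have hsub := Finset.erase_subset_erase a hAB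
    rcases hsub.eq_or_ssubset with h | h
    · have : c A = c B := by simp [c, h]
      simp only [f, this]
      linarith [hsmono A B hAB h]
    · have h1 : c A + 1 ≤ c B := hclt h
      have h2 := hcN B
      simp only [f]
      nlinarith [hs0 B, hs1 A, mul_nonneg (sub_nonneg.2 h1)
        (by linarith : 0 ≤ 2 * (Fintype.card N : ℝ) - c A - c B)]
  · have hlin : ∀ A B : Finset N, A.erase a ⊆ B.erase a → f (A ∩ B) + f (A ∪ B) ≤ f A + f B := by
      intro A B h
      have e1 : (A ∩ B).erase a = A.erase a := by
        rw [hinter, Finset.inter_eq_left.2 h]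
      have e2 : (A ∪ B).erase a = B.erase a := by
        rw [Finset.erase_union_distrib, Finset.union_eq_right.2 h]
      have hs : s (A ∩ B) + s (A ∪ B) ≤ s A + s B := by
        simp only [s, e1, e2, Finset.mem_inter, Finset.mem_union]
        have := hΓ _ _ h
        by_cases h1 : a ∈ A <;> by_cases h2 : a ∈ B <;> by_cases h3 : Γ (A.erase a) <;>
          by_cases h4 : Γ (B.erase a) <;> simp_all
      have hc1 : c (A ∩ B) = c A := by simp [c, e1]
      have hc2 : c (A ∪ B) = c B := by simp [c, e2]
      simp only [f, hc1, hc2]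
      linarith
    intro A B
    by_cases h : A.erase a ⊆ B.erase a
    · exact hlin A B h
    by_cases h' : B.erase a ⊆ A.erase a
    · rw [Finset.inter_comm, Finset.union_comm, add_comm (f A)]
      exact hlin B A h'
    have k1 : c (A ∪ B) + c (A ∩ B) = c A + c B := by
      simp only [c, hinter, Finset.erase_union_distrib]
      exact_mod_cast Finset.card_union_add_card_inter (A.erase a) (B.erase a)
    have k2 : c (A ∩ B) + 1 ≤ c A := hclt <| by
      rw [hinter, Finset.ssubset_iff_subset_ne, ne_eq, Finset.inter_eq_left]
      exact ⟨Finset.inter_subset_left, h⟩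
    have k3 : c (A ∩ B) + 1 ≤ c B := hclt <| by
      rw [hinter, Finset.ssubset_iff_subset_ne, ne_eq, Finset.inter_eq_right]
      exact ⟨Finset.inter_subset_right, h'⟩
    have k4 : c (A ∪ B) = c A + c B - c (A ∩ B) := by linarith
    simp only [f, k4]
    nlinarith [hs1 (A ∩ B), hs1 (A ∪ B), hs0 A, hs0 B,
      mul_nonneg (sub_nonneg.2 k2) (sub_nonneg.2 k3)]
  · intro X hX h
    simp [f, c, s, hX, h, Finset.erase_eq_of_notMem]
  · intro X hX h
    simp [f, c, s, hX, h, Finset.erase_eq_of_notMem]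

/-- There is a reduced polymatroid in which `m + 1` times the value at `a` is at most the value of
some set of `l` elements, as long as there is room for Csirmaz's access structure. -/
theorem exists_isReducedPolymatroid_mul_le (a : N) {l m : ℕ} (hlm : l + m < Fintype.card N)
    (hm : m + 1 < 2 ^ l) :
    ∃ (g : Finset N → ℝ) (A : Finset N), IsReducedPolymatroid g a ∧ 0 < g {a} ∧ A.card = l ∧
      (m + 1) * g {a} ≤ g A := by
  obtain ⟨e⟩ : Nonempty (Fin l ⊕ Fin m ↪ {x : N // x ≠ a}) := by
    refine Function.Embedding.nonempty_of_card_le ?_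
    rw [Fintype.card_sum, Fintype.card_fin, Fintype.card_fin, Fintype.card_subtype_compl,
      Fintype.card_subtype_eq]
    omega
  let p : Fin l ↪ N := (Function.Embedding.inl.trans e).trans (Function.Embedding.subtype _)
  let q : Fin m ↪ N := (Function.Embedding.inr.trans e).trans (Function.Embedding.subtype _)
  have hpa : ∀ x, p x ≠ a := fun x => (e (.inl x)).2
  have hqa : ∀ x, q x ≠ a := fun x => (e (.inr x)).2
  have hpq : ∀ x y, p x ≠ q y := fun x y h => by
    have := e.injective (Subtype.ext h)
    simp at this
  obtain ⟨F, hF1, hF2⟩ := exists_nonempty_finset_sequence l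
  let A : Finset N := Finset.univ.map p
  let B : ℕ → Finset N := fun i => (Finset.univ.filter fun y : Fin m => (y : ℕ) < i).map q
  let T : ℕ → Finset N := fun i => (F i).map p
  -- The minimal choice: the upward closure of the sets that must be qualified.
  let Γ : Finset N → Prop := fun X => ∃ i ≤ m, T i ∪ B i ⊆ X
  have hTA : ∀ i, T i ⊆ A := fun i => Finset.map_subset_map.2 (Finset.subset_univ _)
  have hABd : ∀ i, Disjoint A (B i) := fun i => by
    rw [Finset.disjoint_left]
    intro x hx hx'
    obtain ⟨y, -, rfl⟩ := Finset.mem_map.1 hx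
    obtain ⟨z, -, hz⟩ := Finset.mem_map.1 hx'
    exact hpq _ _ hz.symm
  have hnB : ∀ i, ¬ Γ (B i) := by
    rintro i ⟨j, hj, hsub⟩
    obtain ⟨x, hx⟩ := hF1 j (by omega)
    have hx' : p x ∈ T j := Finset.mem_map_of_mem _ hx
    exact Finset.disjoint_left.1 (hABd i) (hTA j hx') (hsub (Finset.mem_union_left _ hx'))
  have hB0 : B 0 = ∅ := by simp [B]
  have hnT : ∀ i < m, ¬ Γ (T (i + 1) ∪ B i) := by
    rintro i hi ⟨j, hj, hsub⟩
    rcases le_or_gt j i with hji | hji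
    · refine hF2 j (i + 1) (by omega) (by omega) fun x hx => ?_
      have hx' : p x ∈ T j := Finset.mem_map_of_mem _ hx
      rcases Finset.mem_union.1 (hsub (Finset.mem_union_left _ hx')) with h | h
      · exact (Finset.mem_map' _).1 h
      · exact absurd h (Finset.disjoint_left.1 (hABd i) (hTA j hx'))
    · have hy : q ⟨i, hi⟩ ∈ B j := Finset.mem_map_of_mem _ (by simpa using hji)
      rcases Finset.mem_union.1 (hsub (Finset.mem_union_right _ hy)) with h | h
      · exact Finset.disjoint_left.1 (hABd j) (hTA _ h) hy
      · have := (Finset.mem_map' _).1 h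
        simp at this
  obtain ⟨f, hf, hf1, hf2⟩ := exists_isPolymatroid_of_accessStructure a Γ
    fun X Y hXY ⟨i, hi, h⟩ => ⟨i, hi, h.trans hXY⟩
  obtain ⟨h, hh, hha, hred⟩ := hf.exists_isReducedPolymatroid_sub a
  have hga : (f - h) {a} = 1 := by
    have h1 := hf2 ∅ (by simp) (hB0 ▸ hnB 0)
    have h2 := hha ∅ (by simp)
    rw [insert_empty_eq, hf.pointed] at h1
    rw [insert_empty_eq, hh.pointed] at h2
    simp [h1, h2]
  refine ⟨f - h, A, hred, by rw [hga]; exact one_pos, by simp [A], ?_⟩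
  refine hred.1.mul_le_of_accessStructure Γ (B := B) (T := T) ?_ ?_ ?_ ?_ hTA ?_ hABd hB0 ?_ ?_
    hnT (hnB m)
  · intro X hX hΓX
    simp [hf1 X hX hΓX, hha X hX]
  · intro X hX hΓX
    rw [hga]
    simp only [Pi.sub_apply, hf2 X hX hΓX, hha X hX]
    ring
  · simp [A, hpa]
  · simp [B, hqa]
  · intro i
    refine Finset.map_subset_map.2 fun y => ?_
    simp only [Finset.mem_filter, Finset.mem_univ, true_and]
    omega
  · exact fun i hi => ⟨i, hi, Finset.union_subset_union_left (hTA i)⟩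
  · exact fun i hi => ⟨i, hi, subset_rfl⟩

/-- Averaging: the `l` singletons in `A` have total value at least `(m + 1) * g {a}`. -/
theorem le_reducedLambda (a : N) {l m : ℕ} (hl : 0 < l) (hlm : l + m < Fintype.card N)
    (hm : m + 1 < 2 ^ l) : (((m + 1) / l : ℝ) : EReal) ≤ reducedLambda a := by
  obtain ⟨g, A, hg, ha, hA, hle⟩ := exists_isReducedPolymatroid_mul_le a hlm hm
  refine le_trans ?_ (le_sSup ⟨g, hg, ha, rfl⟩)
  rw [EReal.coe_le_coe_iff, div_le_iff₀ (by exact_mod_cast hl)]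
  have h1 : ∀ x ∈ A, g {x} ≤ maxRatio g a * g {a} := fun x _ => by
    rw [← div_le_iff₀ ha]
    exact Finset.le_sup' (fun b : N => g {b} / g {a}) (Finset.mem_univ x)
  have h2 := (hg.1.le_sum_singleton A).trans (Finset.sum_le_sum h1)
  rw [Finset.sum_const, hA, nsmul_eq_mul] at h2
  refine le_of_mul_le_mul_right ?_ ha
  linarith

end

/-! ### Numerical estimate for `l = ⌊log₂ n⌋` and the largest admissible `m + 1`. -/

theorem div_two_mul_logb_le_div_log {n : ℕ} (hn : 1 < n) :
    (n : ℝ) / (2 * Real.logb 2 n) ≤ (min (n - Nat.log 2 n) (2 ^ Nat.log 2 n - 1) : ℕ) /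
      (Nat.log 2 n : ℝ) := by
  set l := Nat.log 2 n with hl
  have hl1 : 1 ≤ l := Nat.log_pos (by norm_num) hn
  have hlow : 2 ^ l ≤ n := Nat.pow_log_le_self 2 (by omega)
  have hupp : n < 2 ^ (l + 1) := Nat.lt_pow_succ_log_self (by norm_num) n
  have hlpos : (0 : ℝ) < l := by exact_mod_cast hl1
  have hL : (l : ℝ) ≤ Real.logb 2 n := by
    rw [Real.le_logb_iff_rpow_le (by norm_num) (by positivity), Real.rpow_natCast]
    exact_mod_cast hlow
  have h2l : l + 1 ≤ 2 ^ l := Nat.lt_two_pow_self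
  have h2l' : 2 * l ≤ 2 ^ l := by
    obtain ⟨k, hk⟩ : ∃ k, l = k + 1 := ⟨l - 1, by omega⟩
    have := Nat.lt_two_pow_self (n := k)
    rw [hk, pow_succ]
    omega
  have hnpos : (0 : ℝ) < n := by positivity
  rcases min_choice (n - l) (2 ^ l - 1) with h | h <;> rw [h]
  · rw [Nat.cast_sub (by omega)]
    calc (n : ℝ) / (2 * Real.logb 2 n) ≤ n / (2 * l) := by gcongr
      _ ≤ (n - l) / l := by
        rw [div_le_div_iff₀ (by positivity) hlpos]
        have : (2 * l : ℝ) ≤ n := by exact_mod_cast h2l'.trans hlow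
        nlinarith
  · rw [Nat.cast_sub Nat.one_le_two_pow]
    push_cast
    have hR : ((l : ℝ) + 1) ≤ 2 ^ l := by exact_mod_cast h2l
    have h3 : (2 : ℝ) ^ l / (l + 1) ≤ (2 ^ l - 1) / l := by
      rw [div_le_div_iff₀ (by positivity) hlpos]
      nlinarith
    refine le_trans ?_ h3
    -- The comparison of `n` with `2 ^ (l + 1)` uses that `log x / x` decreases for `x ≥ e`, so `n =
    -- 2` is separate.
    rcases Nat.lt_or_ge n 3 with h4 | h4
    · obtain rfl : n = 2 := by omega
      have : l = 1 := by
        by_contra hne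
        have : 2 ^ 2 ≤ 2 ^ l := Nat.pow_le_pow_right two_pos (by omega)
        omega
      rw [this]
      norm_num
    · have h5 : Real.exp 1 ≤ n := by
        have : (3 : ℝ) ≤ n := by exact_mod_cast h4
        linarith [Real.exp_one_lt_three]
      have h6 : (n : ℝ) ≤ 2 ^ (l + 1) := by exact_mod_cast hupp.le
      have h7 := Real.log_div_self_antitoneOn h5 (h5.trans h6) h6
      simp only [Real.log_pow] at h7
      have hlog2 : 0 < Real.log 2 := Real.log_pos (by norm_num)
      rw [div_le_div_iff₀ (by positivity) hnpos] at h7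
      have h8 : Real.log n = Real.logb 2 n * Real.log 2 := by
        rw [Real.logb, div_mul_cancel₀ _ hlog2.ne']
      rw [h8] at h7
      rw [div_le_div_iff₀ (by linarith) (by positivity)]
      refine le_of_mul_le_mul_right ?_ hlog2
      rw [pow_succ] at h7
      push_cast at h7
      linarith

theorem theorem1 (n : ℕ) (hn : 1 < n) {N : Type*} [Fintype N] [DecidableEq N]
    (hN : Fintype.card N = n) (a : N) :
    (((n : ℝ) / (2 * Real.logb 2 (n : ℝ)) : ℝ) : EReal) ≤ reducedLambda a ∧
      reducedLambda a < (((2 : ℝ) ^ (2 ^ n : ℕ) : ℝ) : EReal) := by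
  refine ⟨?_, hN ▸ reducedLambda_lt a⟩
  have hl : 0 < Nat.log 2 n := Nat.log_pos (by norm_num) hn
  have hlt : Nat.log 2 n < n := Nat.log_lt_self 2 (by omega)
  have hpow : 1 < 2 ^ Nat.log 2 n := Nat.one_lt_two_pow hl.ne'
  have h1 := div_two_mul_logb_le_div_log hn
  obtain ⟨m, hm⟩ : ∃ m, min (n - Nat.log 2 n) (2 ^ Nat.log 2 n - 1) = m + 1 :=
    ⟨min (n - Nat.log 2 n) (2 ^ Nat.log 2 n - 1) - 1, by omega⟩
  rw [hm, Nat.cast_succ] at h1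
  exact (EReal.coe_le_coe_iff.2 h1).trans (le_reducedLambda a hl (by omega) (by omega))
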